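/- Let $\mathbb{K}$ be an algebraically closed field of characteristic $0$ with a nontrivial (rank-one) non-archimedean valuation $val:\mathbb{K}\to\mathbb{R}\cup\{\infty\}$ whose residue field also has characteristic $0$. Let $d\ge 1$, let $A\subset\mathbb{Z}^d$ be a finite nonempty set, and let $f=\bigoplus_{i\in A}p_i\odot w^i$ be a tropical (min-plus) Laurent polynomial with support $A$, that is $p_i\in\mathbb{R}$ for all $i\in A$ and $f(w)=\min_{i\in A}(p_i+\langle i,w\rangle)$; assume that every $p_i$ lies in the value group $\Gamma=val(\mathbb{K}^*)$. The tropical hypersurface $\mathcal{T}(f)$ is the set of $w\in\mathbb{R}^d$ at which this minimum is attained for at least two different $i\in A$; for the zero tropical polynomial (the empty sum, constant $\infty$) put $\mathcal{T}(\infty)=\mathbb{R}^d$. A point $q\in\mathcal{T}(f)$ is a singular point of $\mathcal{T}(f)$ if there are a Laurent polynomial $F=\sum_{i\in A}a_ix^i$ over $\mathbb{K}$ with $val(a_i)=p_i$ for all $i\in A$ and a point $b\in(\mathbb{K}^*)^d$ with $val(b_k)=q_k$ for all $k$ such that $F(b)=0$ and $\frac{\partial F}{\partial x_k}(b)=0$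 for all $k$; $f$ defines a singular tropical hypersurface if $\mathcal{T}(f)$ has a singular point. For an integral affine function $L(w)=j_1w_1+\dots+j_dw_d+\beta$ with $j_1,\dots,j_d,\beta\in\mathbb{Z}$, the tropical Euler derivative of $f$ is $\frac{\partial f}{\partial L}=\bigoplus_{i\in A,\,L(i)\ne0}p_i\odot w^i$. Let $\mathcal{L}$ be the set of those $L$ with $\gcd(j_1,\dots,j_d)=1$ for which the affine span of $\{L=0\}\cap A$ in $\mathbb{R}^d$ has dimension $d-1$. 1. Let $q\in\mathcal{T}(f)$ have coordinates in $\Gamma$. Then $q$ is a singular point of $\mathcal{T}(f)$ if and only if $q\in\mathcal{T}\left(\frac{\partial f}{\partial L}\right)$ for every integral affine function $L$. 2. $f$ defines a singular tropical hypersurface if and only if $\bigcap_L\mathcal{T}\left(\frac{\partial f}{\partial L}\right)\neq\emptyset$, where $L$ ranges over all integral affine functions and the intersection is taken in $\mathbb{R}^d$. 3. There is a finite set $S$ of integral affine functions with $\bigcap_L\mathcal{T}\left(\frac{\partial f}{\partial L}\right)=\bigcap_{L\in S}\mathcal{T}\left(\frac{\partial f}{\partial L}\right)$. Moreover $\mathcal{L}$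 is finite, and if the convex hull of $A$ is full-dimensional (the affine span of $A$ is $\mathbb{R}^d$), then $\bigcap_L\mathcal{T}\left(\frac{\partial f}{\partial L}\right)=\bigcap_{L\in\mathcal{L}}\mathcal{T}\left(\frac{\partial f}{\partial L}\right)$. -/

import Mathlib

noncomputable section

namespace TropicalSingular

/-- Tropical (min-plus) Laurent polynomials in `d` variables: finite formal sums of monomials
`p_i ⊙ w^i`, `i ∈ ℤ^d`, over the tropical semifield `ℝ ∪ {∞}`, whose zero is `∞`. The support of `f`
is the finite set `f.coeff.support` of those `i` with `p_i ≠ ∞`. -/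
abbrev TropPoly (d : ℕ) := AddMonoidAlgebra (Tropical (WithTop ℝ)) (Fin d → ℤ)

/-- Laurent polynomials in `d` variables with coefficients in `K`. -/
abbrev LaurentPoly (K : Type*) [Field K] (d : ℕ) := AddMonoidAlgebra K (Fin d → ℤ)

/-- The inclusion of the lattice `ℤ^d` in `ℝ^d`. -/
def latticePt {d : ℕ} (i : Fin d → ℤ) : Fin d → ℝ := fun k => (i k : ℝ)

/-- The tropical monomial `w^i = ⟨i, w⟩`. -/
def tropMonomial {d : ℕ} (i : Fin d → ℤ) (w : Fin d → ℝ) : Tropical (WithTop ℝ) :=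
  Tropical.trop ((latticePt i ⬝ᵥ w : ℝ) : WithTop ℝ)

/-- The value `f(w)`, the tropical sum (minimum) of the terms `p_i ⊙ w^i`. -/
def TropPoly.eval {d : ℕ} (f : TropPoly d) (w : Fin d → ℝ) : Tropical (WithTop ℝ) :=
  ∑ i ∈ f.coeff.support, f.coeff i * tropMonomial i w

/-- The tropical hypersurface `T(f)`: the points where the minimum is attained by at least two
terms. The zero tropical polynomial (constant `∞`) defines the whole space. -/
def TropPoly.hypersurface {d : ℕ} (f : TropPoly d) : Set (Fin d → ℝ) :=
  {w | f = 0 ∨ ∃ i₁ ∈ f.coeff.support, ∃ i₂ ∈ f.coeff.support, i₁ ≠ i₂ ∧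
    f.eval w = f.coeff i₁ * tropMonomial i₁ w ∧ f.eval w = f.coeff i₂ * tropMonomial i₂ w}

/-- Integral affine functions `L(w) = j₁ w₁ + ⋯ + j_d w_d + β` with `j ∈ ℤ^d`, `β ∈ ℤ`. -/
structure IntAffine (d : ℕ) where
  /-- the linear part `(j₁, …, j_d)` -/
  lin : Fin d → ℤ
  /-- the constant `β` -/
  const : ℤ

/-- The value of `L` at a lattice point. -/
def IntAffine.eval {d : ℕ} (L : IntAffine d) (i : Fin d → ℤ) : ℤ := L.lin ⬝ᵥ i + L.const

/-- The tropical Euler derivative `∂f/∂L`: the terms of `f` with `L(i) ≠ 0`. -/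
def TropPoly.eulerDeriv {d : ℕ} (f : TropPoly d) (L : IntAffine d) : TropPoly d :=
  AddMonoidAlgebra.ofCoeff (f.coeff.filter fun i => L.eval i ≠ 0)

/-- The affine span of a set of lattice points has dimension `k` (the affine span of the empty set
has no dimension in `ℕ`). -/
def HasAffineDim {d : ℕ} (S : Set (Fin d → ℤ)) (k : ℕ) : Prop :=
  S.Nonempty ∧ Module.finrank ℝ (affineSpan ℝ (latticePt '' S)).direction = k

/-- The set `𝓛` of integral affine functions with coprime linear coefficients whose zero set meets
`A` in a set with affine span of dimension `d - 1`. -/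
def hyperplaneFunctions {d : ℕ} (A : Finset (Fin d → ℤ)) : Set (IntAffine d) :=
  {L | Finset.univ.gcd L.lin = 1 ∧
    ∃ k : ℕ, k + 1 = d ∧ HasAffineDim {i | i ∈ A ∧ L.eval i = 0} k}

section Lift

variable {K : Type*} [Field K]

/-- The value of a Laurent polynomial at a point of the torus `(K^*)^d`. -/
def LaurentPoly.eval {d : ℕ} (F : LaurentPoly K d) (b : Fin d → Kˣ) : K :=
  ∑ i ∈ F.coeff.support, F.coeff i * ((∏ k, b k ^ i k : Kˣ) : K)

/-- The formal partial derivative `∂F/∂x_k`. -/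
def LaurentPoly.partialDeriv {d : ℕ} (F : LaurentPoly K d) (k : Fin d) : LaurentPoly K d :=
  ∑ i ∈ F.coeff.support, AddMonoidAlgebra.single (i - Pi.single k 1) ((i k : K) * F.coeff i)

/-- `b` is a singular point of the hypersurface `V(F)` in the torus defined by `F`. -/
def LaurentPoly.IsSingularAt {d : ℕ} (F : LaurentPoly K d) (b : Fin d → Kˣ) : Prop :=
  LaurentPoly.eval F b = 0 ∧ ∀ k, LaurentPoly.eval (LaurentPoly.partialDeriv F k) b = 0

/-- The tropicalization of `F`, obtained by replacing each coefficient by its valuation. -/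
def LaurentPoly.trop {d : ℕ} (v : AddValuation K (WithTop ℝ)) (F : LaurentPoly K d) : TropPoly d :=
  AddMonoidAlgebra.ofCoeff (F.coeff.mapRange (fun a => Tropical.trop (v a)) (by simp))

/-- `q` is a singular point of `T(f)`: some Laurent polynomial `F` with tropicalization `f` has a
singular point `b` in the torus with coordinatewise valuation `q`. -/
def IsSingularPoint {d : ℕ} (v : AddValuation K (WithTop ℝ)) (f : TropPoly d) (q : Fin d → ℝ) :
    Prop :=
  q ∈ f.hypersurface ∧ ∃ (F : LaurentPoly K d) (b : Fin d → Kˣ),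
    LaurentPoly.trop v F = f ∧ (∀ k, v (b k : K) = ((q k : ℝ) : WithTop ℝ)) ∧
      LaurentPoly.IsSingularAt F b

/-- `f` defines a singular tropical hypersurface. -/
def IsSingularHypersurface {d : ℕ} (v : AddValuation K (WithTop ℝ)) (f : TropPoly d) : Prop :=
  ∃ q, IsSingularPoint v f q

end Lift

end TropicalSingular

end

/-!
Write `A` for the support of `f` and `m i = p_i + ⟨i, q⟩` for the weight of `i ∈ A` at `q`. Then `q`
lies on every `T(∂f/∂L)` iff no `L` has a term that is strictly smallest among those with
`L(i) ≠ 0` (`TropPoly.mem_hypersurface_eulerDeriv_iff`); this depends only on the order of the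
weights.

A polynomial `F` is singular at `b` iff the numbers `c_i = a_i b^i` form an affine relation on `A`:
`∑ c_i = 0` and `∑ c_i i = 0`, and the valuation of `c_i` is `m i`. Then `∑ c_i L(i) = 0` for all
`L`, and since nonzero integers have valuation `0`, no term of this sum is strictly dominant
(`exists_le_of_relation`). Conversely, by linear duality over `ℚ`, the condition on all `L` puts
each `i₀ ∈ A` on a rational affine relation among points of weight at most `m i₀`
(`exists_affine_relation`); a generic combination of these, weighted by elements of valuation `m i₀`,
has exactly the required valuations (`exists_lift_of_weights`).

If only a real point `q` is given, the value group `Γ` is a nonzero `ℚ`-subspace of `ℝ`, and a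
`ℚ`-linear retraction of `ℝ` onto `Γ` sufficiently close to the identity moves `q` into `Γ^d`
without changing the order of the weights (`exists_mem_eulerDeriv_valueSpace`).

Only finitely many polynomials `∂f/∂L` occur, which gives the finite set `S`. A function in `𝓛` is
determined up to sign by its zeros on `A` (`eq_or_eq_neg_of_zeros_eq`). Finally, if `L` has a
strictly smallest term, at `i₀`, then so does any `L'` with `L'(i₀) ≠ 0` whose zeros on `A` include
those of `L`, and such an `L'` with a maximal set of zeros lies in `𝓛`
(`exists_mem_hyperplaneFunctions`).
-/

/-! ### Integral affine functions -/

namespace TropicalSingular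

lemma IntAffine.eval_eq_sum {d : ℕ} (L : IntAffine d) (i : Fin d → ℤ) :
    L.eval i = ∑ k, i k * L.lin k + L.const := by
  simp [IntAffine.eval, dotProduct, mul_comm]

/-- An affine function with coefficients in any `ℚ`-vector space that does not vanish at `i₀` can be
replaced by an integral one that vanishes wherever it does, and still not at `i₀`: compose with a
`ℚ`-linear functional and clear denominators. -/
lemma exists_intAffine_of_module {V : Type*} [AddCommGroup V] [Module ℚ V] {d : ℕ}
    (u : Fin d → V) (β : V) (i₀ : Fin d → ℤ) (h₀ : ∑ k, i₀ k • u k + β ≠ 0) :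
    ∃ L : IntAffine d, L.eval i₀ ≠ 0 ∧ ∀ i, ∑ k, i k • u k + β = 0 → L.eval i = 0 := by
  obtain ⟨φ, hφ⟩ := Module.Projective.exists_dual_ne_zero ℚ h₀
  obtain ⟨b, hb⟩ := IsLocalization.exist_integer_multiples_of_finite (nonZeroDivisors ℤ)
    (fun o : Option (Fin d) => o.elim (φ β) (fun k => φ (u k)))
  choose n hn using hb
  have hb0 : ((b : ℤ) : ℚ) ≠ 0 := by exact_mod_cast nonZeroDivisors.coe_ne_zero b
  have key : ∀ i : Fin d → ℤ, (((⟨fun k => n (some k), n none⟩ : IntAffine d).eval i : ℤ) : ℚ)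
      = (b : ℤ) * φ (∑ k, i k • u k + β) := by
    intro i
    have h1 : (n none : ℚ) = (b : ℤ) * φ β := by simpa [Submonoid.smul_def] using hn none
    have h2 : ∀ k, (n (some k) : ℚ) = (b : ℤ) * φ (u k) := fun k => by
      simpa [Submonoid.smul_def] using hn (some k)
    simp only [IntAffine.eval_eq_sum, Int.cast_add, Int.cast_sum, Int.cast_mul, h1, h2, map_add,
      map_sum, map_zsmul, zsmul_eq_mul, mul_add, Finset.mul_sum]
    congr 1
    exact Finset.sum_congr rfl fun k _ => by ring
  refine ⟨⟨fun k => n (some k), n none⟩, fun h => ?_, fun i hi => ?_⟩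
  · have := key i₀
    rw [h, Int.cast_zero] at this
    exact mul_ne_zero hb0 hφ this.symm
  · have := key i
    rw [hi, map_zero, mul_zero] at this
    exact_mod_cast this

/-- Dividing out the content of the linear part. -/
lemma IntAffine.exists_primitive {d : ℕ} (L : IntAffine d) {i₀ i₁ : Fin d → ℤ}
    (h₀ : L.eval i₀ ≠ 0) (h₁ : L.eval i₁ = 0) :
    ∃ L' : IntAffine d, Finset.univ.gcd L'.lin = 1 ∧ ∀ i, L'.eval i = 0 ↔ L.eval i = 0 := by
  have hlin : L.lin ≠ 0 := by
    intro h
    simp [IntAffine.eval, h] at h₀ h₁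
    exact h₀ h₁
  obtain ⟨k, hk⟩ := Function.ne_iff.1 hlin
  obtain ⟨j, hj, hgcd⟩ := Finset.extract_gcd L.lin (s := Finset.univ) ⟨k, Finset.mem_univ k⟩
  have hg : Finset.univ.gcd L.lin ≠ 0 := fun h =>
    hk (Finset.gcd_eq_zero_iff.1 h k (Finset.mem_univ k))
  have hc : L.const = Finset.univ.gcd L.lin * -(∑ k, i₁ k * j k) := by
    rw [IntAffine.eval_eq_sum] at h₁
    have : ∑ k, i₁ k * L.lin k = Finset.univ.gcd L.lin * ∑ k, i₁ k * j k := by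
      rw [Finset.mul_sum]
      refine Finset.sum_congr rfl fun k _ => ?_
      rw [hj k (Finset.mem_univ k)]; ring
    linarith
  refine ⟨⟨j, -(∑ k, i₁ k * j k)⟩, hgcd, fun i => ?_⟩
  have : L.eval i = Finset.univ.gcd L.lin *
      (⟨j, -(∑ k, i₁ k * j k)⟩ : IntAffine d).eval i := by
    simp only [IntAffine.eval_eq_sum]
    rw [hc, mul_add, Finset.mul_sum]
    congr 1
    refine Finset.sum_congr rfl fun k _ => ?_
    rw [hj k (Finset.mem_univ k)]; ring
  rw [this, mul_eq_zero, or_iff_right hg]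

/-- The linear part of `L` as a functional on `ℝ^d`. -/
def IntAffine.realLin {d : ℕ} (L : IntAffine d) : (Fin d → ℝ) →ₗ[ℝ] ℝ :=
  Fintype.linearCombination ℝ (fun k => (L.lin k : ℝ))

lemma IntAffine.realLin_apply {d : ℕ} (L : IntAffine d) (x : Fin d → ℝ) :
    L.realLin x = ∑ k, x k * L.lin k := by
  simp [IntAffine.realLin, Fintype.linearCombination_apply]

lemma IntAffine.realLin_latticePt {d : ℕ} (L : IntAffine d) (i : Fin d → ℤ) :
    L.realLin (latticePt i) + L.const = L.eval i := by
  simp [IntAffine.realLin_apply, IntAffine.eval_eq_sum, latticePt]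

/-- A linear functional that is constant on `S` vanishes on the direction of the affine span
of `S`. -/
lemma direction_affineSpan_le_ker {V : Type*} [AddCommGroup V] [Module ℝ V] {S : Set V}
    (φ : V →ₗ[ℝ] ℝ) (c : ℝ) (h : ∀ x ∈ S, φ x = c) :
    (affineSpan ℝ S).direction ≤ LinearMap.ker φ := by
  rw [direction_affineSpan, vectorSpan_def, Submodule.span_le]
  rintro _ ⟨x, hx, y, hy, rfl⟩
  simp [h x hx, h y hy]

lemma IntAffine.direction_le_ker {d : ℕ} (L : IntAffine d) {S : Set (Fin d → ℤ)}
    (h : ∀ i ∈ S, L.eval i = 0) :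
    (affineSpan ℝ (latticePt '' S)).direction ≤ LinearMap.ker L.realLin := by
  refine direction_affineSpan_le_ker _ (-L.const) ?_
  rintro _ ⟨i, hi, rfl⟩
  have := L.realLin_latticePt i
  rw [h i hi, Int.cast_zero] at this
  linarith

lemma finrank_ker_add_one {d : ℕ} {φ : (Fin d → ℝ) →ₗ[ℝ] ℝ} (hφ : φ ≠ 0) :
    Module.finrank ℝ (LinearMap.ker φ) + 1 = d := by
  have := Module.Dual.finrank_ker_add_one_of_ne_zero (K := ℝ) (f := φ) hφ
  simpa using this

lemma IntAffine.realLin_ne_zero {d : ℕ} {L : IntAffine d} (h : L.lin ≠ 0) : L.realLin ≠ 0 := by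
  obtain ⟨k, hk⟩ := Function.ne_iff.1 h
  intro h0
  have := L.realLin_apply (Pi.single k 1)
  simp [h0, Pi.single_apply] at this
  exact hk (by exact_mod_cast this.symm)

lemma lin_ne_zero_of_gcd {d : ℕ} {L : IntAffine d} (h : Finset.univ.gcd L.lin = 1) :
    L.lin ≠ 0 := by
  intro h0
  have : Finset.univ.gcd L.lin = 0 := Finset.gcd_eq_zero_iff.2 fun k _ => by rw [h0]; rfl
  omega

/-- Two primitive integral vectors spanning the same line agree up to sign. -/
lemma eq_or_eq_neg_of_primitive {d : ℕ} {a b : Fin d → ℤ} (ha : Finset.univ.gcd a = 1)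
    (hb : Finset.univ.gcd b = 1) (h : ∀ k l, a k * b l = a l * b k) : b = a ∨ b = -a := by
  obtain ⟨u, hu⟩ := Finset.univ.gcd_eq_sum_mul a
  rw [ha] at hu
  have hr : ∀ l, b l = (∑ k, b k * u k) * a l := fun l => by
    calc b l = (∑ k, a k * u k) * b l := by rw [← hu, one_mul]
      _ = _ := by
        rw [Finset.sum_mul, Finset.sum_mul]
        refine Finset.sum_congr rfl fun k _ => ?_
        linear_combination u k * h k l
  have hdvd : (∑ k, b k * u k) ∣ 1 := by
    rw [← hb]
    exact Finset.dvd_gcd fun l _ => ⟨a l, hr l⟩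
  rcases Int.isUnit_iff.1 (isUnit_of_dvd_one hdvd) with h1 | h1
  · left; ext l; rw [hr l, h1, one_mul]
  · right; ext l; rw [hr l, h1]; simp

/-- A function in `𝓛` is determined up to sign by its zero set on `A`. -/
lemma eq_or_eq_neg_of_zeros_eq {d : ℕ} {A : Finset (Fin d → ℤ)} {L L' : IntAffine d}
    (hL : L ∈ hyperplaneFunctions A) (hL' : L' ∈ hyperplaneFunctions A)
    (h : ∀ i ∈ A, L.eval i = 0 ↔ L'.eval i = 0) :
    L' = L ∨ L' = ⟨-L.lin, -L.const⟩ := by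
  obtain ⟨hg, n, hn, ⟨z, hzA, hz⟩, hdim⟩ := hL
  obtain ⟨hg', -⟩ := hL'
  have hker : ∀ M : IntAffine d, M.lin ≠ 0 → (∀ i ∈ {i | i ∈ A ∧ L.eval i = 0}, M.eval i = 0) →
      (affineSpan ℝ (latticePt '' {i | i ∈ A ∧ L.eval i = 0})).direction
        = LinearMap.ker M.realLin := fun M hM hz => by
    refine Submodule.eq_of_le_of_finrank_eq (M.direction_le_ker hz) ?_
    have := finrank_ker_add_one (IntAffine.realLin_ne_zero hM)
    omega
  have heq : LinearMap.ker L.realLin = LinearMap.ker L'.realLin :=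
    (hker L (lin_ne_zero_of_gcd hg) fun i hi => hi.2).symm.trans
      (hker L' (lin_ne_zero_of_gcd hg') fun i hi => (h i hi.1).1 hi.2)
  have hprop : ∀ k l, L.lin k * L'.lin l = L.lin l * L'.lin k := fun k l => by
    -- `a_k e_l - a_l e_k` lies in the kernel of `L`, hence in that of `L'`
    have h1 : ∀ M : IntAffine d, M.realLin
        ((L.lin k : ℝ) • Pi.single l 1 - (L.lin l : ℝ) • Pi.single k 1) =
          L.lin k * M.lin l - L.lin l * M.lin k := fun M => by
      simp [IntAffine.realLin_apply, Pi.single_apply, sub_mul]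
    have h2 : ((L.lin k : ℝ) • Pi.single l 1 - (L.lin l : ℝ) • Pi.single k 1 : Fin d → ℝ) ∈
        LinearMap.ker L'.realLin := by
      rw [← heq, LinearMap.mem_ker, h1]; ring
    rw [LinearMap.mem_ker, h1, sub_eq_zero] at h2
    exact_mod_cast h2
  have hz' := (h z hzA).1 hz
  obtain ⟨a, β⟩ := L
  obtain ⟨a', β'⟩ := L'
  simp only [IntAffine.eval] at hz hz'
  rcases eq_or_eq_neg_of_primitive hg hg' hprop with h1 | h1
  · left
    simp only at h1; subst h1
    congr 1; linarith
  · right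
    simp only at h1; subst h1
    rw [neg_dotProduct] at hz'
    congr 1; simp only; linarith

lemma finite_hyperplaneFunctions {d : ℕ} (A : Finset (Fin d → ℤ)) :
    (hyperplaneFunctions A).Finite := by
  refine Set.Finite.of_finite_fibers (fun L : IntAffine d => A.filter fun i => L.eval i = 0)
    ((A.powerset.finite_toSet).subset ?_) ?_
  · rintro _ ⟨L, -, rfl⟩
    exact Finset.mem_coe.2 (Finset.mem_powerset.2 (Finset.filter_subset _ _))
  · rintro _ ⟨L, hL, rfl⟩
    refine (Set.toFinite {L, ⟨-L.lin, -L.const⟩}).subset ?_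
    rintro L' ⟨hL', hmem⟩
    refine eq_or_eq_neg_of_zeros_eq hL hL' fun i hi => ?_
    have := Finset.ext_iff.1 (Set.mem_singleton_iff.1 hmem) i
    simpa [hi, iff_comm] using this

/-- If `A` affinely spans `ℝ^d`, then any integral affine function that does not vanish at
`i₀ ∈ A` can be replaced by a member of `𝓛` that vanishes at all points of `A` where it does, and
still not at `i₀`. Among the functions with these two properties, one with the largest zero set
on `A` cuts out a hyperplane: otherwise some further affine function could be used to eliminate
its value at one more point of `A`. -/
lemma exists_mem_hyperplaneFunctions {d : ℕ} (hd : 0 < d) {A : Finset (Fin d → ℤ)}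
    (hA : affineSpan ℝ (latticePt '' (A : Set (Fin d → ℤ))) = ⊤) (L : IntAffine d)
    {i₀ : Fin d → ℤ} (h₀ : L.eval i₀ ≠ 0) :
    ∃ L' ∈ hyperplaneFunctions A, L'.eval i₀ ≠ 0 ∧
      ∀ i ∈ A, L.eval i = 0 → L'.eval i = 0 := by
  classical
  have hmax : ∃ M : IntAffine d, (M.eval i₀ ≠ 0 ∧ ∀ i ∈ A, L.eval i = 0 → M.eval i = 0) ∧
      ∀ M' : IntAffine d, (M'.eval i₀ ≠ 0 ∧ ∀ i ∈ A, L.eval i = 0 → M'.eval i = 0) →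
        (A.filter fun i => M'.eval i = 0).card ≤ (A.filter fun i => M.eval i = 0).card := by
    let P : ℕ → Prop := fun n => ∃ M : IntAffine d,
      (M.eval i₀ ≠ 0 ∧ ∀ i ∈ A, L.eval i = 0 → M.eval i = 0) ∧
        (A.filter fun i => M.eval i = 0).card = n
    have hP : P (Nat.findGreatest P A.card) :=
      Nat.findGreatest_spec (Finset.card_filter_le _ _) ⟨L, ⟨h₀, fun _ _ h => h⟩, rfl⟩
    obtain ⟨M, hM, hMc⟩ := hP
    refine ⟨M, hM, fun M' hM' => ?_⟩
    rw [hMc]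
    exact Nat.le_findGreatest (Finset.card_filter_le _ _) ⟨M', hM', rfl⟩
  obtain ⟨M, ⟨hM0, hML⟩, hM⟩ := hmax
  -- a real affine function vanishing at `i₀` and at the zeros of `M` on `A` is constant
  have key : ∀ (φ : (Fin d → ℝ) →ₗ[ℝ] ℝ) (c : ℝ), φ (latticePt i₀) + c = 0 →
      (∀ i ∈ A, M.eval i = 0 → φ (latticePt i) + c = 0) → φ = 0 := by
    intro φ c hφ0 hφ
    by_contra hne
    obtain ⟨x, hxA, hx⟩ : ∃ x ∈ A, φ (latticePt x) + c ≠ 0 := by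
      by_contra! hcon
      have := direction_affineSpan_le_ker (S := latticePt '' (A : Set (Fin d → ℤ))) φ (-c) (by
        rintro _ ⟨i, hi, rfl⟩
        linarith [hcon i hi])
      rw [hA, AffineSubspace.direction_top, top_le_iff, LinearMap.ker_eq_top] at this
      exact hne this
    have hφs : ∀ y : Fin d → ℝ, φ y = ∑ k, y k * φ (Pi.single k 1) := fun y => by
      conv_lhs => rw [pi_eq_sum_univ' y]
      simp
    set s := φ (latticePt x) + c with hs
    -- this combination of `M` and `φ + c` vanishes at `x` but not at `i₀`
    have hval : ∀ i : Fin d → ℤ,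
        ∑ k, i k • (s * M.lin k - M.eval x * φ (Pi.single k 1)) + (s * M.const - M.eval x * c)
          = s * M.eval i - M.eval x * (φ (latticePt i) + c) := fun i => by
      rw [← M.realLin_latticePt i, IntAffine.realLin_apply, hφs (latticePt i)]
      simp only [zsmul_eq_mul, mul_sub, Finset.sum_sub_distrib, mul_add, Finset.mul_sum, latticePt]
      have e1 : ∑ k, (i k : ℝ) * (s * M.lin k) = ∑ k, s * ((i k : ℝ) * M.lin k) :=
        Finset.sum_congr rfl fun k _ => by ring
      have e2 : ∑ k, (i k : ℝ) * (M.eval x * φ (Pi.single k 1)) =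
          ∑ k, (M.eval x : ℝ) * ((i k : ℝ) * φ (Pi.single k 1)) :=
        Finset.sum_congr rfl fun k _ => by ring
      rw [e1, e2]; ring
    obtain ⟨M', hM'0, hM'⟩ := exists_intAffine_of_module _ _ i₀ (by
      rw [hval, hφ0, mul_zero, sub_zero]
      exact mul_ne_zero hx (by exact_mod_cast hM0))
    have hM'Z : ∀ i ∈ A, M.eval i = 0 → M'.eval i = 0 := fun i hi h => hM' i (by
      rw [hval, h, hφ i hi h]; simp)
    have hM'x : M'.eval x = 0 := hM' x (by rw [hval, ← hs]; ring)
    have hMx : M.eval x ≠ 0 := fun h => hx (hφ x hxA h)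
    refine absurd (hM M' ⟨hM'0, fun i hi h => hM'Z i hi (hML i hi h)⟩) (not_le.2 ?_)
    refine Finset.card_lt_card ((Finset.ssubset_iff_of_subset ?_).2 ⟨x, ?_, ?_⟩)
    · exact fun i hi => Finset.mem_filter.2
        ⟨(Finset.mem_filter.1 hi).1, hM'Z i (Finset.mem_filter.1 hi).1 (Finset.mem_filter.1 hi).2⟩
    · exact Finset.mem_filter.2 ⟨hxA, hM'x⟩
    · exact fun h => hMx (Finset.mem_filter.1 h).2
  obtain ⟨z, hzA, hz⟩ : ∃ z ∈ A, M.eval z = 0 := by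
    by_contra! hcon
    have := key (LinearMap.proj ⟨0, hd⟩) (-(latticePt i₀ ⟨0, hd⟩)) (by simp)
      (fun i hi h => absurd h (hcon i hi))
    have := LinearMap.congr_fun this (Pi.single ⟨0, hd⟩ 1)
    simp at this
  obtain ⟨L', hL'g, hL'⟩ := M.exists_primitive hM0 hz
  have hset : {i | i ∈ A ∧ L'.eval i = 0} = {i | i ∈ A ∧ M.eval i = 0} := by
    ext i; simp [hL']
  have hL'r := IntAffine.realLin_ne_zero (lin_ne_zero_of_gcd hL'g)
  refine ⟨L', ⟨hL'g, d - 1, by omega, ⟨z, hzA, (hL' z).2 hz⟩, ?_⟩,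
    fun h => hM0 ((hL' i₀).1 h), fun i hi h => (hL' i).2 (hML i hi h)⟩
  have hdir : (affineSpan ℝ (latticePt '' {i | i ∈ A ∧ L'.eval i = 0})).direction
      = LinearMap.ker L'.realLin := by
    refine le_antisymm (L'.direction_le_ker fun i hi => hi.2) fun x hx => ?_
    by_contra hxW
    obtain ⟨φ, hφx, hφW⟩ := Submodule.exists_le_ker_of_notMem hxW
    have hconst : ∀ i ∈ A, M.eval i = 0 → φ (latticePt i) = φ (latticePt z) := fun i hi h => by
      have : latticePt i -ᵥ latticePt z ∈
          (affineSpan ℝ (latticePt '' {i | i ∈ A ∧ L'.eval i = 0})).direction :=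
        AffineSubspace.vsub_mem_direction
          (subset_affineSpan ℝ _ ⟨i, ⟨hi, (hL' i).2 h⟩, rfl⟩)
          (subset_affineSpan ℝ _ ⟨z, ⟨hzA, (hL' z).2 hz⟩, rfl⟩)
      have := hφW this
      simpa [sub_eq_zero] using this
    -- subtract a multiple of `L'` to make the value at `i₀` zero
    have h0 : (L'.eval i₀ : ℝ) ≠ 0 := by exact_mod_cast fun h => hM0 ((hL' i₀).1 h)
    have := key ((L'.eval i₀ : ℝ) • φ - (φ (latticePt i₀) - φ (latticePt z)) • L'.realLin)
      (-(L'.eval i₀ * φ (latticePt z)) - (φ (latticePt i₀) - φ (latticePt z)) * L'.const)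
      (by
        have := L'.realLin_latticePt i₀
        simp only [LinearMap.sub_apply, LinearMap.smul_apply, smul_eq_mul]
        linear_combination -(φ (latticePt i₀) - φ (latticePt z)) * this)
      (fun i hi h => by
        have := L'.realLin_latticePt i
        rw [(hL' i).2 h, Int.cast_zero] at this
        simp only [LinearMap.sub_apply, LinearMap.smul_apply, smul_eq_mul, hconst i hi h]
        linear_combination -(φ (latticePt i₀) - φ (latticePt z)) * this)
    have := LinearMap.congr_fun this x
    rw [LinearMap.mem_ker] at hx
    simp only [LinearMap.sub_apply, LinearMap.smul_apply, smul_eq_mul, hx, mul_zero, sub_zero,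
      LinearMap.zero_apply] at this
    exact mul_ne_zero h0 hφx this
  have := finrank_ker_add_one hL'r
  rw [hdir]; omega

end TropicalSingular

/-! ### Kernel vectors with prescribed valuations -/

namespace TropicalSingular

/-- If no integral affine function isolates the smallest weight at `i₀`, then `i₀` takes part in a
rational affine relation among points of weight at most `m i₀`. -/
lemma exists_affine_relation {d : ℕ} {A : Finset (Fin d → ℤ)} {m : (Fin d → ℤ) → ℝ}
    {i₀ : Fin d → ℤ} (hi₀ : i₀ ∈ A)
    (h : ∀ L : IntAffine d, L.eval i₀ ≠ 0 →
      ∃ i ∈ A, L.eval i ≠ 0 ∧ i ≠ i₀ ∧ m i ≤ m i₀) :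
    ∃ u : (Fin d → ℤ) → ℚ, u i₀ ≠ 0 ∧ (∀ i, u i ≠ 0 → m i ≤ m i₀) ∧ ∑ i ∈ A, u i = 0 ∧
      ∀ k, ∑ i ∈ A, u i * i k = 0 := by
  classical
  -- homogenization: affine relations among the `i` are linear relations among the `e i`
  let e : (Fin d → ℤ) → (Fin d → ℚ) × ℚ := fun i => (fun k => (i k : ℚ), 1)
  set B := A.filter fun i => i ≠ i₀ ∧ m i ≤ m i₀ with hB
  have hmem : e i₀ ∈ Submodule.span ℚ (e '' (B : Set (Fin d → ℤ))) := by
    by_contra hnot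
    obtain ⟨φ, hφ0, hφ⟩ := Submodule.exists_le_ker_of_notMem hnot
    have hval : ∀ i : Fin d → ℤ,
        ∑ k, i k • φ (Pi.single k 1, 0) + φ (0, 1) = φ (e i) := fun i => by
      have : e i = ∑ k, i k • ((Pi.single k 1, 0) : (Fin d → ℚ) × ℚ) + (0, 1) := by
        ext k
        · simp [e, Prod.fst_sum, Finset.sum_apply, Pi.single_apply]
        · simp [e, Prod.snd_sum]
      rw [this, map_add, map_sum]
      simp only [map_zsmul]
    obtain ⟨L, hL0, hL⟩ := exists_intAffine_of_module (fun k => φ (Pi.single k 1, 0)) (φ (0, 1)) i₀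
      (by rw [hval]; exact hφ0)
    obtain ⟨i, hiA, hLi, hne, hle⟩ := h L hL0
    refine hLi (hL i ?_)
    rw [hval]
    exact hφ (Submodule.subset_span ⟨i, Finset.mem_coe.2 (Finset.mem_filter.2 ⟨hiA, hne, hle⟩), rfl⟩)
  obtain ⟨c₀, hc₀⟩ := Submodule.mem_span_image_finset_iff_exists_fun ℚ |>.1 hmem
  obtain ⟨c, hc⟩ : ∃ c : (Fin d → ℤ) → ℚ, ∑ i ∈ B, c i • e i = e i₀ :=
    ⟨fun i => if hi : i ∈ B then c₀ ⟨i, hi⟩ else 0, by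
      rw [← hc₀, ← Finset.sum_coe_sort B]
      exact Finset.sum_congr rfl fun i _ => by simp⟩
  set u : (Fin d → ℤ) → ℚ := fun i => if i = i₀ then -1 else if i ∈ B then c i else 0 with hu
  have hsum : ∑ i ∈ A, u i • e i = 0 := by
    rw [← Finset.add_sum_erase _ _ hi₀]
    have h1 : ∑ i ∈ A.erase i₀, u i • e i = ∑ i ∈ B, c i • e i := by
      symm
      refine Finset.sum_subset_zero_on_sdiff ?_ ?_ ?_
      · intro i hi
        rw [hB, Finset.mem_filter] at hi
        exact Finset.mem_erase.2 ⟨hi.2.1, hi.1⟩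
      · intro i hi
        rw [Finset.mem_sdiff, Finset.mem_erase] at hi
        simp [hu, hi.1.1, hi.2]
      · intro i hi
        have : i ≠ i₀ := (Finset.mem_filter.1 (hB ▸ hi)).2.1
        simp only [hu, if_neg this, if_pos hi]
    rw [h1, hc]
    simp [hu]
  refine ⟨u, by simp [hu], fun i hi => ?_, ?_, fun k => ?_⟩
  · by_cases h1 : i = i₀
    · rw [h1]
    · by_cases h2 : i ∈ B
      · exact (Finset.mem_filter.1 (hB ▸ h2)).2.2
      · simp [hu, h1, h2] at hi
  · simpa [Prod.snd_sum, e] using congrArg Prod.snd hsum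
  · simpa [Prod.fst_sum, e, Finset.sum_apply] using congrFun (congrArg Prod.fst hsum) k

section Valuation

variable {K : Type*} [Field K] (v : AddValuation K (WithTop ℝ))

/-- If the residue field has characteristic zero, nonzero integers are units of the valuation
ring. -/
lemma valuation_intCast
    (hres : CharZero (IsLocalRing.ResidueField v.toValuation.valuationSubring))
    {n : ℤ} (hn : n ≠ 0) : v (n : K) = 0 := by
  have h1 : IsLocalRing.residue v.toValuation.valuationSubring (n : v.toValuation.valuationSubring)
      ≠ 0 := by
    rw [map_intCast]
    exact_mod_cast hn
  rw [Ne, IsLocalRing.residue_eq_zero_iff, Valuation.mem_maximalIdeal_iff] at h1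
  have h2 := v.toValuation.mem_valuationSubring_iff (n : K) |>.1
    (n : v.toValuation.valuationSubring).2
  exact le_antisymm (not_lt.1 h1) h2

lemma valuation_ratCast [CharZero K]
    (hres : CharZero (IsLocalRing.ResidueField v.toValuation.valuationSubring))
    {r : ℚ} (hr : r ≠ 0) : v (r : K) = 0 := by
  have h1 : (r : K) * ((r.den : ℤ) : K) = (r.num : ℤ) := by
    have := Rat.mul_den_eq_num r
    exact_mod_cast congrArg (Rat.cast : ℚ → K) this
  have h2 := congrArg v h1
  rwa [v.map_mul, valuation_intCast v hres (by exact_mod_cast r.den_ne_zero),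
    valuation_intCast v hres (Rat.num_ne_zero.2 hr), add_zero] at h2

/-- Lifting for the linear space of affine relations on `A`: weights in the value group for which
no integral affine function has a unique minimal nonzero term are the valuations of an affine
relation over `K`. Writing `τ r` for an element of valuation `r`, the relation is
`∑ λ_i τ(m i) u⁽ⁱ⁾`, where `u⁽ⁱ⁾` is a rational relation through `i` among points of weight at most
`m i` and the rational numbers `λ_i` are generic. -/
lemma exists_lift_of_weights [CharZero K]
    (hres : CharZero (IsLocalRing.ResidueField v.toValuation.valuationSubring))
    {d : ℕ} {A : Finset (Fin d → ℤ)} {m : (Fin d → ℤ) → ℝ}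
    (hm : ∀ i ∈ A, ∃ x : K, v x = (m i : WithTop ℝ))
    (h : ∀ L : IntAffine d, ∀ i₀ ∈ A, L.eval i₀ ≠ 0 →
      ∃ i ∈ A, L.eval i ≠ 0 ∧ i ≠ i₀ ∧ m i ≤ m i₀) :
    ∃ c : (Fin d → ℤ) → K, (∀ i ∈ A, v (c i) = (m i : WithTop ℝ)) ∧ ∑ i ∈ A, c i = 0 ∧
      ∀ k, ∑ i ∈ A, c i * i k = 0 := by
  classical
  have hrel : ∀ i₀ : A, ∃ u : (Fin d → ℤ) → ℚ, u i₀ ≠ 0 ∧ (∀ i, u i ≠ 0 → m i ≤ m i₀) ∧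
      ∑ i ∈ A, u i = 0 ∧ ∀ k, ∑ i ∈ A, u i * i k = 0 := fun i₀ =>
    exists_affine_relation i₀.2 fun L hL => h L i₀ i₀.2 hL
  choose u hu0 hule husum hulin using hrel
  have hτ : ∃ τ : ℝ → K, ∀ i ∈ A, v (τ (m i)) = (m i : WithTop ℝ) := by
    have : ∀ r : ℝ, ∃ x : K, (∃ y : K, v y = (r : WithTop ℝ)) → v x = (r : WithTop ℝ) := fun r => by
      by_cases hr : ∃ y : K, v y = (r : WithTop ℝ)
      · exact ⟨hr.choose, fun _ => hr.choose_spec⟩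
      · exact ⟨0, fun h => absurd h hr⟩
    choose τ hτ using this
    exact ⟨τ, fun i hi => hτ _ (hm i hi)⟩
  obtain ⟨τ, hτ⟩ := hτ
  -- generic rational coefficients: the leading coefficient at each `i` is nonzero
  let φ : A → Module.Dual ℚ (A → ℚ) := fun i =>
    Fintype.linearCombination ℚ (fun j : A => if m j = m i then u j i else 0)
  have hφ : ∀ (i : A) (l : A → ℚ), φ i l = ∑ j : A, if m j = m i then l j * u j i else 0 :=
    fun i l => by simp [φ, Fintype.linearCombination_apply]
  obtain ⟨l, hl⟩ := Module.Dual.exists_forall_ne_zero_of_forall_exists φ fun i =>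
    ⟨Pi.single i 1, by
      rw [hφ, Finset.sum_eq_single i]
      · simpa using hu0 i
      · intro j _ hj; simp [hj]
      · simp⟩
  refine ⟨fun i => ∑ j : A, ((l j * u j i : ℚ) : K) * τ (m j), fun i hi => ?_, ?_, fun k => ?_⟩
  · have hsplit : ∑ j : A, ((l j * u j i : ℚ) : K) * τ (m j) =
        ((φ ⟨i, hi⟩ l : ℚ) : K) * τ (m i) +
          ∑ j ∈ Finset.univ.filter (fun j : A => ¬ m j = m i), ((l j * u j i : ℚ) : K) * τ (m j) := by
      rw [← Finset.sum_filter_add_sum_filter_not Finset.univ (fun j : A => m j = m i)]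
      congr 1
      rw [hφ, ← Finset.sum_filter, Rat.cast_sum, Finset.sum_mul]
      exact Finset.sum_congr rfl fun j hj => by rw [(Finset.mem_filter.1 hj).2]
    have hlead : v (((φ ⟨i, hi⟩ l : ℚ) : K) * τ (m i)) = (m i : WithTop ℝ) := by
      rw [v.map_mul, valuation_ratCast v hres (hl _), hτ i hi, zero_add]
    simp only [hsplit]
    rw [v.map_add_eq_of_lt_left, hlead]
    rw [hlead]
    refine v.map_lt_sum WithTop.coe_ne_top fun j hj => ?_
    have hj' : m j ≠ m i := (Finset.mem_filter.1 hj).2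
    by_cases hz : l j * u j i = 0
    · rw [hz, Rat.cast_zero, zero_mul, v.map_zero]
      exact WithTop.coe_lt_top _
    · rw [v.map_mul, valuation_ratCast v hres hz, hτ j j.2, zero_add]
      exact_mod_cast lt_of_le_of_ne (hule j i (right_ne_zero_of_mul hz)) hj'.symm
  · rw [Finset.sum_comm]
    refine Finset.sum_eq_zero fun j _ => ?_
    rw [← Finset.sum_mul, ← Rat.cast_sum, ← Finset.mul_sum, husum]
    simp
  · simp only [Finset.sum_mul]
    rw [Finset.sum_comm]
    refine Finset.sum_eq_zero fun j _ => ?_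
    calc ∑ i ∈ A, ((l j * u j i : ℚ) : K) * τ (m j) * (i k : K)
        = ((l j * ∑ i ∈ A, u j i * i k : ℚ) : K) * τ (m j) := by
          push_cast
          rw [Finset.mul_sum, Finset.sum_mul]
          exact Finset.sum_congr rfl fun i _ => by ring
      _ = 0 := by rw [hulin]; simp

/-- An affine relation over `K` cannot have a unique term of least valuation after multiplication
by the values of an integral affine function. -/
lemma exists_le_of_relation
    (hres : CharZero (IsLocalRing.ResidueField v.toValuation.valuationSubring))
    {d : ℕ} {A : Finset (Fin d → ℤ)} {m : (Fin d → ℤ) → ℝ} {c : (Fin d → ℤ) → K}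
    (hc : ∀ i ∈ A, v (c i) = (m i : WithTop ℝ)) (hsum : ∑ i ∈ A, c i = 0)
    (hlin : ∀ k, ∑ i ∈ A, c i * i k = 0) (L : IntAffine d) {i₀ : Fin d → ℤ} (hi₀ : i₀ ∈ A)
    (hL : L.eval i₀ ≠ 0) : ∃ i ∈ A, L.eval i ≠ 0 ∧ i ≠ i₀ ∧ m i ≤ m i₀ := by
  classical
  by_contra! hcon
  have hzero : ∑ i ∈ A, c i * (L.eval i : K) = 0 := by
    simp only [IntAffine.eval_eq_sum, Int.cast_add, Int.cast_sum, Int.cast_mul, mul_add,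
      Finset.sum_add_distrib, Finset.mul_sum]
    rw [← Finset.sum_mul, hsum, zero_mul, add_zero, Finset.sum_comm]
    refine Finset.sum_eq_zero fun k _ => ?_
    simp only [← mul_assoc]
    rw [← Finset.sum_mul, hlin, zero_mul]
  have hlead : v (c i₀ * (L.eval i₀ : K)) = (m i₀ : WithTop ℝ) := by
    rw [v.map_mul, valuation_intCast v hres hL, hc i₀ hi₀, add_zero]
  rw [← Finset.add_sum_erase _ _ hi₀] at hzero
  have hlt : v (c i₀ * (L.eval i₀ : K)) < v (∑ i ∈ A.erase i₀, c i * (L.eval i : K)) := by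
    rw [hlead]
    refine v.map_lt_sum WithTop.coe_ne_top fun i hi => ?_
    obtain ⟨hne, hiA⟩ := Finset.mem_erase.1 hi
    by_cases hz : L.eval i = 0
    · rw [hz, Int.cast_zero, mul_zero, v.map_zero]
      exact WithTop.coe_lt_top _
    · rw [v.map_mul, valuation_intCast v hres hz, hc i hiA, add_zero]
      exact_mod_cast hcon i hiA hz hne
  have := v.map_add_eq_of_lt_left hlt
  rw [hzero, v.map_zero, hlead] at this
  exact WithTop.coe_ne_top this.symm

/-! ### The value group -/

lemma exists_valuation_inv {x : K} {r : ℝ} (hx : v x = (r : WithTop ℝ)) :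
    v x⁻¹ = ((-r : ℝ) : WithTop ℝ) := by
  have h0 : x ≠ 0 := fun h => by rw [h, v.map_zero] at hx; exact WithTop.coe_ne_top hx.symm
  have h1 : v x⁻¹ ≠ ⊤ := v.ne_top_iff.2 (inv_ne_zero h0)
  obtain ⟨s, hs⟩ := WithTop.ne_top_iff_exists.1 h1
  have h2 : v (x * x⁻¹) = 0 := by rw [mul_inv_cancel₀ h0, v.map_one]
  rw [v.map_mul, hx, ← hs] at h2
  have h3 : r + s = 0 := by exact_mod_cast h2
  rw [← hs]
  congr 1; linarith

/-- The value group of an algebraically closed field is divisible, hence a `ℚ`-subspace of `ℝ`. -/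
def valueSpace [IsAlgClosed K] : Submodule ℚ ℝ where
  carrier := {r | ∃ x : K, v x = (r : WithTop ℝ)}
  add_mem' := by
    rintro r s ⟨x, hx⟩ ⟨y, hy⟩
    exact ⟨x * y, by rw [v.map_mul, hx, hy]; rfl⟩
  zero_mem' := ⟨1, v.map_one⟩
  smul_mem' := by
    rintro a r ⟨x, hx⟩
    have hn : ∀ n : ℕ, v (x ^ n) = ((n * r : ℝ) : WithTop ℝ) := fun n => by
      rw [v.map_pow, hx, ← WithTop.coe_nsmul, nsmul_eq_mul]
    have hz : ∃ y : K, v y = ((a.num * r : ℝ) : WithTop ℝ) := by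
      rcases Int.eq_nat_or_neg a.num with ⟨n, hn' | hn'⟩
      · exact ⟨x ^ n, by rw [hn, hn']; rfl⟩
      · exact ⟨(x ^ n)⁻¹, by rw [exists_valuation_inv v (hn n), hn']; simp⟩
    obtain ⟨y, hy⟩ := hz
    obtain ⟨z, hz⟩ := IsAlgClosed.exists_pow_nat_eq y a.den_pos
    have hy0 : v z ≠ ⊤ := by
      rw [v.ne_top_iff]
      rintro rfl
      rw [zero_pow a.den_ne_zero] at hz
      rw [← hz, v.map_zero] at hy
      exact WithTop.coe_ne_top hy.symm
    obtain ⟨s, hs⟩ := WithTop.ne_top_iff_exists.1 hy0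
    refine ⟨z, ?_⟩
    rw [← hz, v.map_pow, ← hs, ← WithTop.coe_nsmul, nsmul_eq_mul] at hy
    have h1 : (a.den : ℝ) * s = a.num * r := by exact_mod_cast hy
    have h2 : (a.den : ℝ) ≠ 0 := by exact_mod_cast a.den_ne_zero
    rw [← hs]
    congr 1
    rw [Rat.smul_def, Rat.cast_def]
    field_simp
    linarith

lemma mem_valueSpace [IsAlgClosed K] {r : ℝ} :
    r ∈ valueSpace v ↔ ∃ x : K, v x = (r : WithTop ℝ) := Iff.rfl

lemma valueSpace_ne_bot [IsAlgClosed K] (hv : ∃ x : K, x ≠ 0 ∧ v x ≠ 0) : valueSpace v ≠ ⊥ := by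
  obtain ⟨x, hx, hvx⟩ := hv
  obtain ⟨r, hr⟩ := WithTop.ne_top_iff_exists.1 (v.ne_top_iff.2 hx)
  refine (Submodule.ne_bot_iff _).2 ⟨r, ⟨x, hr.symm⟩, ?_⟩
  rintro rfl
  exact hvx hr.symm

end Valuation

lemma dense_of_ne_bot {G : Submodule ℚ ℝ} (hG : G ≠ ⊥) : Dense (G : Set ℝ) := by
  obtain ⟨g, hg, hg0⟩ := (Submodule.ne_bot_iff _).1 hG
  have h1 : DenseRange (fun r : ℚ => (r : ℝ) * g) :=
    (mul_right_surjective₀ hg0).denseRange.comp Rat.denseRange_cast (by fun_prop)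
  refine h1.mono ?_
  rintro _ ⟨r, rfl⟩
  simpa [Rat.smul_def] using G.smul_mem r hg

/-- `ℝ` retracts `ℚ`-linearly onto a nonzero `ℚ`-subspace by maps that converge pointwise to the
identity: move the elements of a basis of a complement to nearby elements of the subspace. -/
lemma exists_retractions_tendsto {G : Submodule ℚ ℝ} (hG : G ≠ ⊥) :
    ∃ φ : ℕ → ℝ →ₗ[ℚ] ℝ, (∀ n x, φ n x ∈ G) ∧ (∀ n, ∀ x ∈ G, φ n x = x) ∧
      ∀ x, Filter.Tendsto (fun n => φ n x) Filter.atTop (nhds x) := by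
  obtain ⟨C, hC⟩ := G.exists_isCompl
  let b := Module.Basis.ofVectorSpace ℚ C
  have hseq : ∀ s, ∃ g : ℕ → ℝ, (∀ n, g n ∈ (G : Set ℝ)) ∧
      Filter.Tendsto g Filter.atTop (nhds (b s : ℝ)) := fun s =>
    mem_closure_iff_seq_limit.1 (dense_of_ne_bot hG (b s : ℝ))
  choose g hgG hg using hseq
  let ψ : ℕ → C →ₗ[ℚ] ℝ := fun n => b.constr ℚ fun s => g s n
  have hψ : ∀ n x, ψ n x = ∑ s ∈ (b.repr x).support, b.repr x s • g s n := fun n x => by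
    rw [Module.Basis.constr_apply]; rfl
  refine ⟨fun n => LinearMap.ofIsCompl hC G.subtype (ψ n), fun n x => ?_, fun n x hx => ?_,
    fun x => ?_⟩
  · obtain ⟨y, z, rfl, -⟩ := Submodule.existsUnique_add_of_isCompl hC x
    rw [map_add, LinearMap.ofIsCompl_apply_left, LinearMap.ofIsCompl_apply_right, hψ]
    exact G.add_mem y.2 (G.sum_mem fun s _ => G.smul_mem _ (hgG s n))
  · exact LinearMap.ofIsCompl_apply_left hC ⟨x, hx⟩
  · obtain ⟨y, z, rfl, -⟩ := Submodule.existsUnique_add_of_isCompl hC x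
    simp only [map_add, LinearMap.ofIsCompl_apply_left, LinearMap.ofIsCompl_apply_right, hψ]
    refine tendsto_const_nhds.add ?_
    have hz : (z : ℝ) = ∑ s ∈ (b.repr z).support, b.repr z s • (b s : ℝ) := by
      have := congrArg C.subtype (b.linearCombination_repr z)
      rw [Finsupp.linearCombination_apply, Finsupp.sum, map_sum] at this
      simpa using this.symm
    conv => arg 3; rw [hz]
    exact tendsto_finsetSum _ fun s _ => (hg s).const_smul _

end TropicalSingular

/-! ### Tropical hypersurfaces in terms of weights -/

namespace TropicalSingular

section Weights

variable {d : ℕ} (f : TropPoly d)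

/-- The real number `p_i + ⟨i, w⟩`, the value at `w` of the term of `f` with exponent `i`. It is
meaningful for `i` in the support of `f` only. -/
noncomputable def TropPoly.weight (w : Fin d → ℝ) (i : Fin d → ℤ) : ℝ :=
  (Tropical.untrop (f.coeff i)).untopD 0 + latticePt i ⬝ᵥ w

lemma TropPoly.trop_weight {i : Fin d → ℤ} (hi : i ∈ f.coeff.support) (w : Fin d → ℝ) :
    f.coeff i * tropMonomial i w = Tropical.trop (f.weight w i : WithTop ℝ) := by
  have h : Tropical.untrop (f.coeff i) ≠ ⊤ := fun h => Finsupp.mem_support_iff.1 hi (by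
    rw [← Tropical.trop_untrop (f.coeff i), h]; rfl)
  obtain ⟨r, hr⟩ := WithTop.ne_top_iff_exists.1 h
  rw [← Tropical.trop_untrop (f.coeff i), ← hr, tropMonomial, ← Tropical.trop_add, weight, ← hr]
  rfl

lemma TropPoly.eval_eq_trop_weight_iff {i : Fin d → ℤ} (hi : i ∈ f.coeff.support)
    (w : Fin d → ℝ) :
    f.eval w = f.coeff i * tropMonomial i w ↔ ∀ j ∈ f.coeff.support, f.weight w i ≤ f.weight w j := by
  have hle : ∀ j ∈ f.coeff.support, Tropical.untrop (f.eval w) ≤ (f.weight w j : WithTop ℝ) :=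
    fun j hj => by
      rw [TropPoly.eval, Finset.untrop_sum']
      refine (Finset.inf_le hj).trans ?_
      simp only [Function.comp_apply]
      rw [f.trop_weight hj, Tropical.untrop_trop]
  rw [f.trop_weight hi]
  refine ⟨fun h j hj => ?_, fun h => ?_⟩
  · have := hle j hj
    rw [h, Tropical.untrop_trop] at this
    exact_mod_cast this
  · refine Tropical.untrop_injective (le_antisymm (hle i hi) ?_)
    rw [TropPoly.eval, Finset.untrop_sum', Tropical.untrop_trop]
    refine Finset.le_inf fun j hj => ?_
    simp only [Function.comp_apply]
    rw [f.trop_weight hj, Tropical.untrop_trop]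
    exact_mod_cast h j hj

/-- A point is on the hypersurface iff no term is strictly smaller than all the others. -/
lemma TropPoly.mem_hypersurface_iff (w : Fin d → ℝ) :
    w ∈ f.hypersurface ↔ ∀ i₀ ∈ f.coeff.support,
      ∃ i ∈ f.coeff.support, i ≠ i₀ ∧ f.weight w i ≤ f.weight w i₀ := by
  constructor
  · rintro (rfl | ⟨i₁, h₁, i₂, h₂, hne, e₁, e₂⟩) i₀ hi₀
    · simp at hi₀
    · rw [f.eval_eq_trop_weight_iff h₁] at e₁
      rw [f.eval_eq_trop_weight_iff h₂] at e₂
      by_cases h : i₁ = i₀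
      · exact ⟨i₂, h₂, fun h' => hne (h.trans h'.symm), e₂ i₀ hi₀⟩
      · exact ⟨i₁, h₁, h, e₁ i₀ hi₀⟩
  · intro h
    rcases f.coeff.support.eq_empty_or_nonempty with h0 | hne
    · left
      rw [Finsupp.support_eq_empty] at h0
      exact AddMonoidAlgebra.coeff_injective h0
    · right
      obtain ⟨i₁, h₁, hmin⟩ := f.coeff.support.exists_min_image (f.weight w) hne
      obtain ⟨i₂, h₂, hne, hle⟩ := h i₁ h₁
      exact ⟨i₁, h₁, i₂, h₂, hne.symm, (f.eval_eq_trop_weight_iff h₁ w).2 hmin,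
        (f.eval_eq_trop_weight_iff h₂ w).2 fun j hj => hle.trans (hmin j hj)⟩

lemma TropPoly.mem_support_eulerDeriv {L : IntAffine d} {i : Fin d → ℤ} :
    i ∈ (f.eulerDeriv L).coeff.support ↔ i ∈ f.coeff.support ∧ L.eval i ≠ 0 := by
  simp [TropPoly.eulerDeriv, and_comm]

lemma TropPoly.weight_eulerDeriv {L : IntAffine d} {i : Fin d → ℤ} (h : L.eval i ≠ 0)
    (w : Fin d → ℝ) : (f.eulerDeriv L).weight w i = f.weight w i := by
  simp [TropPoly.weight, TropPoly.eulerDeriv, h]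

lemma TropPoly.mem_hypersurface_eulerDeriv_iff (L : IntAffine d) (w : Fin d → ℝ) :
    w ∈ (f.eulerDeriv L).hypersurface ↔ ∀ i₀ ∈ f.coeff.support, L.eval i₀ ≠ 0 →
      ∃ i ∈ f.coeff.support, L.eval i ≠ 0 ∧ i ≠ i₀ ∧ f.weight w i ≤ f.weight w i₀ := by
  rw [TropPoly.mem_hypersurface_iff]
  constructor
  · intro h i₀ hi₀ hL
    obtain ⟨i, hi, hne, hle⟩ := h i₀ (f.mem_support_eulerDeriv.2 ⟨hi₀, hL⟩)
    obtain ⟨hi, hLi⟩ := f.mem_support_eulerDeriv.1 hi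
    rw [f.weight_eulerDeriv hL, f.weight_eulerDeriv hLi] at hle
    exact ⟨i, hi, hLi, hne, hle⟩
  · intro h i₀ hi₀
    obtain ⟨hi₀, hL⟩ := f.mem_support_eulerDeriv.1 hi₀
    obtain ⟨i, hi, hLi, hne, hle⟩ := h i₀ hi₀ hL
    refine ⟨i, f.mem_support_eulerDeriv.2 ⟨hi, hLi⟩, hne, ?_⟩
    rwa [f.weight_eulerDeriv hL, f.weight_eulerDeriv hLi]

lemma TropPoly.eulerDeriv_one : f.eulerDeriv ⟨0, 1⟩ = f := by
  refine AddMonoidAlgebra.coeff_injective (Finsupp.ext fun i => ?_)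
  simp [TropPoly.eulerDeriv, IntAffine.eval]

lemma TropPoly.finite_range_eulerDeriv : (Set.range f.eulerDeriv).Finite := by
  classical
  refine ((f.coeff.support.powerset.finite_toSet).image fun s =>
    (AddMonoidAlgebra.ofCoeff (f.coeff.filter (· ∈ s)) : TropPoly d)).subset ?_
  rintro _ ⟨L, rfl⟩
  refine ⟨f.coeff.support.filter fun i => L.eval i ≠ 0,
    Finset.mem_coe.2 (Finset.mem_powerset.2 (Finset.filter_subset _ _)), ?_⟩
  refine congrArg AddMonoidAlgebra.ofCoeff (Finsupp.ext fun i => ?_)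
  by_cases h : f.coeff i = 0
  · simp [Finsupp.filter_apply, h]
  · simp [Finsupp.filter_apply, h]

lemma TropPoly.exists_finset_iInter_eq : ∃ S : Finset (IntAffine d),
    (⋂ L : IntAffine d, (f.eulerDeriv L).hypersurface) =
      ⋂ L ∈ S, (f.eulerDeriv L).hypersurface := by
  obtain ⟨S, -, hS⟩ := Set.exists_subset_bijOn Set.univ f.eulerDeriv
  have hfin : S.Finite := Set.Finite.of_finite_image
    (f.finite_range_eulerDeriv.subset (Set.image_subset_range _ _)) hS.injOn
  refine ⟨hfin.toFinset, Set.Subset.antisymm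
    (Set.subset_iInter₂ fun L _ => Set.iInter_subset _ L) fun w hw => Set.mem_iInter.2 fun L => ?_⟩
  obtain ⟨L', hL', h⟩ := hS.surjOn ⟨L, Set.mem_univ L, rfl⟩
  rw [← h]
  exact Set.mem_iInter₂.1 hw L' (hfin.mem_toFinset.2 hL')

lemma TropPoly.iInter_eq_biInter_hyperplaneFunctions (hd : 0 < d)
    (hA : affineSpan ℝ (latticePt '' (f.coeff.support : Set (Fin d → ℤ))) = ⊤) :
    (⋂ L : IntAffine d, (f.eulerDeriv L).hypersurface) =
      ⋂ L ∈ hyperplaneFunctions f.coeff.support, (f.eulerDeriv L).hypersurface := by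
  refine Set.Subset.antisymm
    (Set.subset_iInter₂ fun L _ => Set.iInter_subset _ L) fun w hw => ?_
  rw [Set.mem_iInter]
  intro L
  rw [f.mem_hypersurface_eulerDeriv_iff]
  intro i₀ hi₀ hL
  obtain ⟨L', hL', hL'0, hL'z⟩ := exists_mem_hyperplaneFunctions hd hA L hL
  obtain ⟨i, hi, hLi, hne, hle⟩ :=
    (f.mem_hypersurface_eulerDeriv_iff L' w).1 (Set.mem_iInter₂.1 hw L' hL') i₀ hi₀ hL'0
  exact ⟨i, hi, fun h => hLi (hL'z i hi h), hne, hle⟩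

end Weights

/-! ### Singular points and affine relations -/

section Singular

variable {K : Type*} [Field K] {d : ℕ}

lemma LaurentPoly.eval_eq_sum (F : LaurentPoly K d) (b : Fin d → Kˣ) :
    LaurentPoly.eval F b =
      Finsupp.linearCombination K (fun i => ((∏ k, b k ^ i k : Kˣ) : K)) F.coeff := by
  simp [LaurentPoly.eval, Finsupp.linearCombination_apply, Finsupp.sum]

/-- `b_k` times the `k`-th partial derivative of `F` at `b` is the value of the `k`-th Euler
derivative. -/
lemma LaurentPoly.mul_eval_partialDeriv (F : LaurentPoly K d) (b : Fin d → Kˣ) (k : Fin d) :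
    (b k : K) * LaurentPoly.eval (LaurentPoly.partialDeriv F k) b =
      ∑ i ∈ F.coeff.support, F.coeff i * ((∏ l, b l ^ i l : Kˣ) : K) * i k := by
  have hb : ∀ i : Fin d → ℤ,
      b k * ∏ l, b l ^ ((i - Pi.single k 1 : Fin d → ℤ) l) = ∏ l, b l ^ i l := fun i => by
    simp only [Pi.sub_apply, zpow_sub, Finset.prod_mul_distrib, Finset.prod_inv_distrib]
    have : ∏ l, b l ^ (Pi.single k 1 : Fin d → ℤ) l = b k := by
      rw [Finset.prod_eq_single k]
      · simp
      · intro l _ hl; simp [hl]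
      · simp
    rw [this, mul_comm, inv_mul_cancel_right]
  rw [LaurentPoly.eval_eq_sum, LaurentPoly.partialDeriv, AddMonoidAlgebra.coeff_sum, map_sum,
    Finset.mul_sum]
  refine Finset.sum_congr rfl fun i _ => ?_
  rw [AddMonoidAlgebra.coeff_single, Finsupp.linearCombination_single, ← hb i, smul_eq_mul,
    Units.val_mul]
  ring

lemma LaurentPoly.isSingularAt_iff (F : LaurentPoly K d) (b : Fin d → Kˣ) :
    LaurentPoly.IsSingularAt F b ↔
      ∑ i ∈ F.coeff.support, F.coeff i * ((∏ l, b l ^ i l : Kˣ) : K) = 0 ∧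
      ∀ k, ∑ i ∈ F.coeff.support, F.coeff i * ((∏ l, b l ^ i l : Kˣ) : K) * i k = 0 := by
  refine and_congr Iff.rfl (forall_congr' fun k => ?_)
  rw [← LaurentPoly.mul_eval_partialDeriv, mul_eq_zero, or_iff_right (b k).ne_zero]

variable (v : AddValuation K (WithTop ℝ))

lemma valuation_zpow {b : Kˣ} {r : ℝ} (h : v (b : K) = (r : WithTop ℝ)) (n : ℤ) :
    v ((b ^ n : Kˣ) : K) = ((n * r : ℝ) : WithTop ℝ) := by
  have hn : ∀ n : ℕ, v ((b : K) ^ n) = ((n * r : ℝ) : WithTop ℝ) := fun n => by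
    rw [v.map_pow, h, ← WithTop.coe_nsmul, nsmul_eq_mul]
  rcases Int.eq_nat_or_neg n with ⟨m, rfl | rfl⟩
  · simpa using hn m
  · rw [zpow_neg, zpow_natCast, Units.val_inv_eq_inv_val, Units.val_pow_eq_pow_val,
      exists_valuation_inv v (hn m)]
    simp

lemma valuation_monomial {b : Fin d → Kˣ} {q : Fin d → ℝ}
    (h : ∀ k, v (b k : K) = ((q k : ℝ) : WithTop ℝ)) (i : Fin d → ℤ) :
    v ((∏ l, b l ^ i l : Kˣ) : K) = ((latticePt i ⬝ᵥ q : ℝ) : WithTop ℝ) := by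
  have : ∀ s : Finset (Fin d), v ((∏ l ∈ s, b l ^ i l : Kˣ) : K) =
      ((∑ l ∈ s, latticePt i l * q l : ℝ) : WithTop ℝ) := fun s => by
    classical
    induction s using Finset.induction_on with
    | empty => simp
    | insert a s ha ih =>
      rw [Finset.prod_insert ha, Finset.sum_insert ha, Units.val_mul, v.map_mul, ih,
        valuation_zpow v (h a)]
      rfl
  exact this _

lemma LaurentPoly.support_trop (F : LaurentPoly K d) :
    (LaurentPoly.trop v F).coeff.support = F.coeff.support := by
  ext i
  have : (LaurentPoly.trop v F).coeff i = 0 ↔ v (F.coeff i) = ⊤ := by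
    rw [← Tropical.untrop_inj_iff]; rfl
  rw [Finsupp.mem_support_iff, Finsupp.mem_support_iff, Ne, this, v.top_iff]

lemma LaurentPoly.valuation_term (F : LaurentPoly K d) {b : Fin d → Kˣ} {q : Fin d → ℝ}
    (h : ∀ k, v (b k : K) = ((q k : ℝ) : WithTop ℝ)) {i : Fin d → ℤ}
    (hi : i ∈ F.coeff.support) :
    v (F.coeff i * ((∏ l, b l ^ i l : Kˣ) : K)) =
      ((LaurentPoly.trop v F).weight q i : WithTop ℝ) := by
  have h1 := (LaurentPoly.trop v F).trop_weight (by rwa [LaurentPoly.support_trop]) q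
  rw [v.map_mul, valuation_monomial v h]
  exact congrArg Tropical.untrop h1

/-- Singular points lie on all tropical Euler derivatives. -/
lemma IsSingularPoint.mem_eulerDeriv
    (hres : CharZero (IsLocalRing.ResidueField v.toValuation.valuationSubring))
    {f : TropPoly d} {q : Fin d → ℝ} (h : IsSingularPoint v f q) (L : IntAffine d) :
    q ∈ (f.eulerDeriv L).hypersurface := by
  obtain ⟨-, F, b, rfl, hb, hF⟩ := h
  obtain ⟨h0, h1⟩ := (LaurentPoly.isSingularAt_iff F b).1 hF
  rw [TropPoly.mem_hypersurface_eulerDeriv_iff, LaurentPoly.support_trop]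
  exact fun i₀ hi₀ hL =>
    exists_le_of_relation v hres (fun i hi => F.valuation_term v hb hi) h0 h1 L hi₀ hL

/-- A point with coordinates in the value group that lies on all tropical Euler derivatives lifts
to a singular point. -/
lemma isSingularPoint_of_mem_eulerDeriv [CharZero K]
    (hres : CharZero (IsLocalRing.ResidueField v.toValuation.valuationSubring))
    {f : TropPoly d} (hfv : ∀ i, ∃ a : K, Tropical.trop (v a) = f.coeff i) {q : Fin d → ℝ}
    (hq : ∀ k, ∃ x : K, v x = ((q k : ℝ) : WithTop ℝ))
    (h : ∀ L : IntAffine d, q ∈ (f.eulerDeriv L).hypersurface) : IsSingularPoint v f q := by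
  classical
  choose x hx using hq
  have hx0 : ∀ k, x k ≠ 0 := fun k => v.ne_top_iff.1 (by rw [hx k]; exact WithTop.coe_ne_top)
  let b : Fin d → Kˣ := fun k => Units.mk0 (x k) (hx0 k)
  have hb : ∀ k, v (b k : K) = ((q k : ℝ) : WithTop ℝ) := hx
  have hmon : ∀ (i : Fin d → ℤ) (a : K),
      Tropical.trop (v (a * ((∏ l, b l ^ i l : Kˣ) : K))) =
        Tropical.trop (v a) * tropMonomial i q := fun i a => by
    rw [v.map_mul, valuation_monomial v hb]; rfl
  obtain ⟨c, hc, hsum, hlin⟩ := exists_lift_of_weights v hres (A := f.coeff.support)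
    (m := f.weight q) (fun i hi => by
      obtain ⟨a, ha⟩ := hfv i
      refine ⟨a * ((∏ l, b l ^ i l : Kˣ) : K), Tropical.trop_injective ?_⟩
      rw [hmon, ha, f.trop_weight hi])
    (fun L => (f.mem_hypersurface_eulerDeriv_iff L q).1 (h L))
  -- dividing the relation `c` by the monomials at `b` gives the coefficients of `F`
  let F : LaurentPoly K d := AddMonoidAlgebra.ofCoeff (Finsupp.onFinset f.coeff.support
    (fun i => if i ∈ f.coeff.support then c i * ((∏ l, b l ^ i l : Kˣ)⁻¹ : Kˣ) else 0)
    (fun i hi => by by_contra h; simp [h] at hi))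
  have hFi : ∀ i ∈ f.coeff.support, F.coeff i * ((∏ l, b l ^ i l : Kˣ) : K) = c i := fun i hi => by
    simp only [F, Finsupp.onFinset_apply, if_pos hi, mul_assoc, Units.inv_mul, mul_one]
  have hF0 : ∀ i ∉ f.coeff.support, F.coeff i = 0 := fun i hi => by
    simp only [F, Finsupp.onFinset_apply, if_neg hi]
  have htrop : LaurentPoly.trop v F = f := by
    refine AddMonoidAlgebra.coeff_injective (Finsupp.ext fun i => ?_)
    change Tropical.trop (v (F.coeff i)) = f.coeff i
    by_cases hi : i ∈ f.coeff.support
    · have h1 := hmon i (F.coeff i)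
      rw [hFi i hi, hc i hi, ← f.trop_weight hi] at h1
      have h2 := congrArg Tropical.untrop h1
      rw [Tropical.untrop_mul, Tropical.untrop_mul, tropMonomial, Tropical.untrop_trop] at h2
      exact Tropical.untrop_injective (WithTop.add_right_cancel WithTop.coe_ne_top h2).symm
    · rw [hF0 i hi, v.map_zero, Finsupp.notMem_support_iff.1 hi]; rfl
  have hsupp : F.coeff.support = f.coeff.support := by rw [← F.support_trop v, htrop]
  refine ⟨f.eulerDeriv_one ▸ h ⟨0, 1⟩, F, b, htrop, hb, (F.isSingularAt_iff b).2 ⟨?_, fun k => ?_⟩⟩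
  · rw [hsupp, Finset.sum_congr rfl hFi, hsum]
  · rw [hsupp, ← hlin k]
    exact Finset.sum_congr rfl fun i hi => by rw [hFi i hi]

/-- If the Euler derivatives of `f` have a common point, they have one with coordinates in the value
group: membership depends only on the order of the weights of `f`, and this order survives
a `ℚ`-linear retraction onto the value group that is close enough to the identity. -/
lemma exists_mem_eulerDeriv_valueSpace [IsAlgClosed K] (hv : ∃ x : K, x ≠ 0 ∧ v x ≠ 0)
    {f : TropPoly d} (hfv : ∀ i, ∃ a : K, Tropical.trop (v a) = f.coeff i) {q : Fin d → ℝ}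
    (h : ∀ L : IntAffine d, q ∈ (f.eulerDeriv L).hypersurface) :
    ∃ q' : Fin d → ℝ, (∀ k, ∃ x : K, v x = ((q' k : ℝ) : WithTop ℝ)) ∧
      ∀ L : IntAffine d, q' ∈ (f.eulerDeriv L).hypersurface := by
  obtain ⟨φ, hφG, hφid, hφ⟩ := exists_retractions_tendsto (valueSpace_ne_bot v hv)
  have hweight : ∀ n, ∀ i ∈ f.coeff.support,
      f.weight (fun k => φ n (q k)) i = φ n (f.weight q i) := fun n i hi => by
    have hp : (Tropical.untrop (f.coeff i)).untopD 0 ∈ valueSpace v := by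
      obtain ⟨a, ha⟩ := hfv i
      have h0 : v a ≠ ⊤ := fun h0 => Finsupp.mem_support_iff.1 hi (by rw [← ha, h0]; rfl)
      obtain ⟨r, hr⟩ := WithTop.ne_top_iff_exists.1 h0
      refine (mem_valueSpace v).2 ⟨a, ?_⟩
      rw [← ha, ← hr]; rfl
    simp only [TropPoly.weight, map_add, hφid n _ hp, dotProduct, latticePt, map_sum]
    congr 1
    refine Finset.sum_congr rfl fun k _ => ?_
    rw [← zsmul_eq_mul, ← zsmul_eq_mul, map_zsmul]
  have hlt : ∀ᶠ n in Filter.atTop, ∀ p ∈ f.coeff.support ×ˢ f.coeff.support,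
      f.weight q p.1 < f.weight q p.2 → φ n (f.weight q p.1) < φ n (f.weight q p.2) := by
    rw [Filter.eventually_all_finset]
    rintro p -
    by_cases hp : f.weight q p.1 < f.weight q p.2
    · filter_upwards [(hφ _).eventually_lt (hφ _) hp] with n hn _ using hn
    · exact Filter.Eventually.of_forall fun n hn => absurd hn hp
  obtain ⟨n, hn⟩ := hlt.exists
  refine ⟨fun k => φ n (q k), fun k => hφG n (q k), fun L => ?_⟩
  rw [f.mem_hypersurface_eulerDeriv_iff]
  intro i₀ hi₀ hL
  obtain ⟨i, hi, hLi, hne, hle⟩ := (f.mem_hypersurface_eulerDeriv_iff L q).1 (h L) i₀ hi₀ hL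
  refine ⟨i, hi, hLi, hne, ?_⟩
  rw [hweight n i hi, hweight n i₀ hi₀]
  rcases hle.lt_or_eq with hlt | heq
  · exact (hn (i, i₀) (Finset.mem_product.2 ⟨hi, hi₀⟩) hlt).le
  · rw [heq]

end Singular

end TropicalSingular

theorem mainTheorem1 {K : Type*} [Field K] [IsAlgClosed K] [CharZero K]
    (v : AddValuation K (WithTop ℝ))
    (hv : ∃ x : K, x ≠ 0 ∧ v x ≠ 0)
    (hres : CharZero (IsLocalRing.ResidueField v.toValuation.valuationSubring))
    {d : ℕ} (hd : 0 < d)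
    (f : TropicalSingular.TropPoly d) (hf : f ≠ 0)
    (hfv : ∀ i, ∃ a : K, Tropical.trop (v a) = f.coeff i) :
    (∀ q ∈ f.hypersurface, (∀ k, ∃ x : K, v x = ((q k : ℝ) : WithTop ℝ)) →
      (TropicalSingular.IsSingularPoint v f q ↔
        ∀ L : TropicalSingular.IntAffine d, q ∈ (f.eulerDeriv L).hypersurface)) ∧
    (TropicalSingular.IsSingularHypersurface v f ↔
      (⋂ L : TropicalSingular.IntAffine d, (f.eulerDeriv L).hypersurface).Nonempty) ∧
    (∃ S : Finset (TropicalSingular.IntAffine d),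
      (⋂ L : TropicalSingular.IntAffine d, (f.eulerDeriv L).hypersurface) =
        ⋂ L ∈ S, (f.eulerDeriv L).hypersurface) ∧
    (TropicalSingular.hyperplaneFunctions f.coeff.support).Finite ∧
    (affineSpan ℝ (TropicalSingular.latticePt '' (f.coeff.support : Set (Fin d → ℤ))) = ⊤ →
      (⋂ L : TropicalSingular.IntAffine d, (f.eulerDeriv L).hypersurface) =
        ⋂ L ∈ TropicalSingular.hyperplaneFunctions f.coeff.support,
          (f.eulerDeriv L).hypersurface) := by
  refine ⟨fun q _ hq => ⟨fun h => h.mem_eulerDeriv v hres,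
      TropicalSingular.isSingularPoint_of_mem_eulerDeriv v hres hfv hq⟩, ⟨?_, ?_⟩,
    f.exists_finset_iInter_eq, TropicalSingular.finite_hyperplaneFunctions _,
    f.iInter_eq_biInter_hyperplaneFunctions hd⟩
  · rintro ⟨q, hq⟩
    exact ⟨q, Set.mem_iInter.2 (hq.mem_eulerDeriv v hres)⟩
  · rintro ⟨q, hq⟩
    obtain ⟨q', hq', h⟩ :=
      TropicalSingular.exists_mem_eulerDeriv_valueSpace v hv hfv (Set.mem_iInter.1 hq)
    exact ⟨q', TropicalSingular.isSingularPoint_of_mem_eulerDeriv v hres hfv hq' h⟩
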